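/- Gaussian Distinguishing is the following problem. Let $\mathcal V$ be a known finite set of unit vectors ("test vectors") in $\mathbb R^N$. An algorithm repeatedly picks a test vector $v\in\mathcal V$ that it has not picked before and receives a real response $a_v$; its choices may depend on all earlier responses and on internal randomness. It finally halts with a one-bit answer. The task is to distinguish two cases: (i) the responses $a_v$ are independent $\mathcal N(0,1)$ variables; (ii) $a_v=\langle\Psi|v\rangle$ for all $v$, where a single vector $\Psi\in\mathbb R^N$ with independent $\mathcal N(0,1)$ coordinates is drawn once and kept fixed. In both cases the responses are independent of the internal randomness. The algorithm distinguishes the cases with bias at least $\delta$ if its probabilities of answering $1$ in case (i) and in case (ii) differ by at least $\delta$. Theorem. For every constant $\delta>0$ there is a constant $c>0$, depending only on $\delta$, such that the following holds. Let $N,M\ge 0$ be integers, let $0<\varepsilon\le 1$, and let $\mathcal V\subset\mathbb R^N$ be a finite set of unit vectors with $|\mathcal V|\le M$ and $|\langle v|w\rangle|\le\varepsilon$ for all distinct $v,w\in\mathcal V$. Then every classical randomized adaptive algorithm that distinguishes the two cases with bias at least $\delta$ makes, in expectation, at least $$c\cdot\frac{1/\varepsilon}{\log(M/\varepsilon)}$$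 queries, both in case (i) and in case (ii); in particular, the maximum number of queries that it makes is at least this large. (If $|\mathcal V|\le 1$, the two cases coincide and no algorithm distinguishes them; in all other cases $M/\varepsilon\ge 2$.) -/

import Mathlib

open MeasureTheory ProbabilityTheory

/-- A classical randomized adaptive query algorithm whose oracle answers queries to test vectors
indexed by `ι` with real numbers.  Its internal randomness is a seed in `Ω`.  Given the seed and the
history of the pairs (queried test vector, response) seen so far, the algorithm either queries a
test vector (`Sum.inl`), which must be one that it has not picked before, or halts with a one-bit
answer (`Sum.inr`). -/
structure QueryAlgorithm (ι Ω : Type*) [MeasurableSpace ι] [MeasurableSpace Ω] where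
  move : Ω → List (ι × ℝ) → ι ⊕ Bool
  fresh : ∀ (ω : Ω) (h : List (ι × ℝ)) (v : ι), move ω h = Sum.inl v → v ∉ h.map Prod.fst
  measurable_move : ∀ k : ℕ,
    Measurable fun p : Ω × (Fin k → ι × ℝ) => move p.1 (List.ofFn p.2)

namespace QueryAlgorithm

variable {ι Ω : Type*} [MeasurableSpace ι] [MeasurableSpace Ω]

/-- The history after at most `k` steps on seed `ω`, when the response to a query of `v` is `a v`.
Once the algorithm has halted, the history no longer changes. -/
def history (A : QueryAlgorithm ι Ω) (ω : Ω) (a : ι → ℝ) : ℕ → List (ι × ℝ)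
  | 0 => []
  | k + 1 =>
    match A.move ω (A.history ω a k) with
    | Sum.inl v => A.history ω a k ++ [(v, a v)]
    | Sum.inr _ => A.history ω a k

/-- The full history of a run.  As no test vector is queried twice, every run has halted once it
has made `Fintype.card ι` steps; see `exists_move_transcript_eq_inr`. -/
def transcript [Fintype ι] (A : QueryAlgorithm ι Ω) (ω : Ω) (a : ι → ℝ) : List (ι × ℝ) :=
  A.history ω a (Fintype.card ι)

/-- The number of queries made in a run. -/
def numQueries [Fintype ι] (A : QueryAlgorithm ι Ω) (ω : Ω) (a : ι → ℝ) : ℕ :=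
  (A.transcript ω a).length

/-- The answer with which a run halts (the branch `Sum.inl` never occurs). -/
def output [Fintype ι] (A : QueryAlgorithm ι Ω) (ω : Ω) (a : ι → ℝ) : Bool :=
  match A.move ω (A.transcript ω a) with
  | Sum.inl _ => false
  | Sum.inr b => b

theorem nodup_history (A : QueryAlgorithm ι Ω) (ω : Ω) (a : ι → ℝ) (k : ℕ) :
    ((A.history ω a k).map Prod.fst).Nodup := by
  induction k with
  | zero => simp [history]
  | succ k ih =>
    rw [history]
    split
    · rename_i v hv
      have := A.fresh _ _ _ hv
      rw [List.map_append, List.nodup_append]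
      refine ⟨ih, by simp, ?_⟩
      intro x hx y hy
      simp only [List.map_cons, List.map_nil, List.mem_singleton] at hy
      rintro rfl
      exact this (hy ▸ hx)
    · exact ih

theorem length_history (A : QueryAlgorithm ι Ω) (ω : Ω) (a : ι → ℝ) (k : ℕ)
    (h : ∀ b, A.move ω (A.history ω a k) ≠ Sum.inr b) : (A.history ω a k).length = k := by
  induction k with
  | zero => simp [history]
  | succ k ih =>
    rw [history] at h ⊢
    split at h
    · rename_i v hv
      simp [ih (by simp [hv])]
    · rename_i b hb
      exact absurd hb (h b)

/-- Every run halts. -/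
theorem exists_move_transcript_eq_inr [Fintype ι] (A : QueryAlgorithm ι Ω) (ω : Ω) (a : ι → ℝ) :
    ∃ b, A.move ω (A.transcript ω a) = Sum.inr b := by
  classical
  by_contra! h
  have hlen := A.length_history ω a _ h
  have hnd := A.nodup_history ω a (Fintype.card ι)
  cases hm : A.move ω (A.transcript ω a) with
  | inr b => exact h b hm
  | inl v =>
    have hcons : (v :: (A.history ω a (Fintype.card ι)).map Prod.fst).Nodup :=
      List.nodup_cons.2 ⟨A.fresh _ _ _ hm, hnd⟩
    have := hcons.length_le_card
    simp [hlen] at this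

/-- The probability that the algorithm answers `true` when its seed has law `P` and, independently,
the responses have law `μ`. -/
noncomputable def acceptProb [Fintype ι] (A : QueryAlgorithm ι Ω) (P : Measure Ω)
    (μ : Measure (ι → ℝ)) : ℝ :=
  (P.prod μ).real {p | A.output p.1 p.2 = true}

/-- The expected number of queries when the seed has law `P` and, independently, the responses
have law `μ`. -/
noncomputable def expectedQueries [Fintype ι] (A : QueryAlgorithm ι Ω) (P : Measure Ω)
    (μ : Measure (ι → ℝ)) : ℝ :=
  ∫ p, (A.numQueries p.1 p.2 : ℝ) ∂(P.prod μ)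

end QueryAlgorithm

/-- Case (i): the responses are independent standard Gaussians. -/
noncomputable def independentLaw {N : ℕ} (V : Finset (EuclideanSpace ℝ (Fin N))) :
    Measure (V → ℝ) :=
  Measure.pi fun _ => gaussianReal 0 1

/-- Case (ii): the response to `v` is the inner product of `Ψ` and `v`, for a single random vector
`Ψ` with independent standard Gaussian coordinates. -/
noncomputable def projectedLaw {N : ℕ} (V : Finset (EuclideanSpace ℝ (Fin N))) :
    Measure (V → ℝ) :=
  (Measure.pi fun _ : Fin N => gaussianReal 0 1).map
    fun Ψ v => inner ℝ (WithLp.toLp 2 Ψ) (v : EuclideanSpace ℝ (Fin N))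

/-- The algorithm distinguishes the two cases of Gaussian Distinguishing with bias at least `δ`. -/
def DistinguishesWithBias {N : ℕ} {V : Finset (EuclideanSpace ℝ (Fin N))} {Ω : Type*}
    [MeasurableSpace Ω] (A : QueryAlgorithm V Ω) (P : Measure Ω) (δ : ℝ) : Prop :=
  δ ≤ |A.acceptProb P (independentLaw V) - A.acceptProb P (projectedLaw V)|

theorem prod_gaussianPDFReal {κ : Type*} [Fintype κ] (z : κ → ℝ) :
    ∏ i, gaussianPDFReal 0 1 (z i) =
      (√(2 * Real.pi))⁻¹ ^ Fintype.card κ * Real.exp (-(z ⬝ᵥ z) / 2) := by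
  simp only [gaussianPDFReal, NNReal.coe_one, mul_one, sub_zero, Finset.prod_mul_distrib,
    Finset.prod_const, Finset.card_univ, ← Real.exp_sum, dotProduct]
  congr 2
  rw [← Finset.sum_div, Finset.sum_neg_distrib]
  simp [sq]

theorem pi_gaussianReal_eq_withDensity (κ : Type*) [Fintype κ] :
    Measure.pi (fun _ : κ => gaussianReal 0 1) =
      volume.withDensity fun z : κ → ℝ => ENNReal.ofReal (∏ i, gaussianPDFReal 0 1 (z i)) := by
  refine Measure.pi_eq fun s hs => ?_
  rw [withDensity_apply _ (MeasurableSet.univ_pi hs), volume_pi, Measure.restrict_pi_pi,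
    ← ofReal_integral_eq_lintegral_ofReal
      (Integrable.fintype_prod fun i => (integrable_gaussianPDFReal 0 1).restrict)
      (Filter.Eventually.of_forall fun z =>
        Finset.prod_nonneg fun i _ => gaussianPDFReal_nonneg 0 1 (z i)),
    integral_fintype_prod_eq_prod (f := fun _ x => gaussianPDFReal 0 1 x),
    ENNReal.ofReal_prod_of_nonneg fun i _ =>
      setIntegral_nonneg (hs i) fun x _ => gaussianPDFReal_nonneg 0 1 x]
  exact Finset.prod_congr rfl fun i _ =>
    (gaussianReal_apply_eq_integral 0 one_ne_zero (s i)).symm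

/-- A linear map that does not increase volume sends the standard Gaussian measure to a measure
whose density relative to the standard Gaussian measure is at least the ratio of the
exponential factors. -/
theorem setLIntegral_exp_le_map_mulVec {κ : Type*} [Fintype κ] [DecidableEq κ]
    {R : Matrix κ κ ℝ} (hR : R.det ≠ 0) (hR1 : |R.det| ≤ 1) {C : Set (κ → ℝ)}
    (hC : MeasurableSet C) :
    ∫⁻ a in C, ENNReal.ofReal
        (Real.exp (-((R⁻¹.mulVec a) ⬝ᵥ (R⁻¹.mulVec a) - a ⬝ᵥ a) / 2))
        ∂(Measure.pi fun _ : κ => gaussianReal 0 1) ≤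
      ((Measure.pi fun _ : κ => gaussianReal 0 1).map R.mulVec) C := by
  have hm : Measurable (R.mulVec) := by
    change Measurable (fun v => R.mulVec v)
    unfold Matrix.mulVec dotProduct; fun_prop
  have hdm : Measurable fun z : κ → ℝ => ENNReal.ofReal (∏ i, gaussianPDFReal 0 1 (z i)) := by
    fun_prop
  have hq : Measurable fun a : κ → ℝ => ENNReal.ofReal
        (Real.exp (-((R⁻¹.mulVec a) ⬝ᵥ (R⁻¹.mulVec a) - a ⬝ᵥ a) / 2)) := by
    unfold Matrix.mulVec dotProduct; fun_prop
  have hi : Measurable (R⁻¹.mulVec) := by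
    change Measurable (fun v => R⁻¹.mulVec v)
    unfold Matrix.mulVec dotProduct; fun_prop
  have hu : IsUnit R.det := hR.isUnit
  have hinv : ∀ z, R⁻¹.mulVec (R.mulVec z) = z := fun z => by
    rw [Matrix.mulVec_mulVec, Matrix.nonsing_inv_mul _ hu, Matrix.one_mulVec]
  have hmap : ∀ g : (κ → ℝ) → ENNReal, Measurable g →
      ∫⁻ a, g a ≤ ∫⁻ z, g (R.mulVec z) := by
    intro g hg
    have h := Real.map_matrix_volume_pi_eq_smul_volume_pi hR
    have h2 : ∫⁻ z, g (R.mulVec z) = ∫⁻ a, g a ∂(Measure.map (Matrix.toLin' R) volume) :=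
      (lintegral_map hg (show Measurable (Matrix.toLin' R) from hm)).symm
    rw [h2, h, lintegral_smul_measure]
    refine le_mul_of_one_le_left zero_le ?_
    rw [ENNReal.one_le_ofReal, abs_inv]
    exact (one_le_inv₀ (abs_pos.2 hR)).2 hR1
  rw [Measure.map_apply hm hC, pi_gaussianReal_eq_withDensity,
    withDensity_apply _ (hm hC), restrict_withDensity hC,
    lintegral_withDensity_eq_lintegral_mul _ hdm hq, ← lintegral_indicator hC,
    ← lintegral_indicator (hm hC)]
  refine (hmap _ ((hdm.mul hq).indicator hC)).trans (lintegral_mono fun z => ?_)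
  by_cases hz : R.mulVec z ∈ C
  · rw [Set.indicator_of_mem hz, Set.indicator_of_mem (show z ∈ R.mulVec ⁻¹' C from hz)]
    simp only [Pi.mul_apply, hinv, prod_gaussianPDFReal]
    rw [← ENNReal.ofReal_mul (by positivity), mul_assoc, ← Real.exp_add]
    refine ENNReal.ofReal_le_ofReal (le_of_eq ?_)
    congr 2
    ring
  · rw [Set.indicator_of_notMem hz]
    exact zero_le

theorem Matrix.PosSemidef.det_le_one_of_diag_eq_one {κ : Type*} [Fintype κ] [DecidableEq κ]
    {G : Matrix κ κ ℝ} (hG : G.PosSemidef) (hd : ∀ i, G i i = 1) : G.det ≤ 1 := by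
  have hsum : ∑ i, (hG.1.eigenvalues i - 1) = 0 := by
    have h := hG.1.trace_eq_sum_eigenvalues
    simp only [Matrix.trace, Matrix.diag_apply, hd, RCLike.ofReal_real_eq_id, id_eq] at h
    rw [Finset.sum_sub_distrib, ← h, sub_self]
  rw [hG.1.det_eq_prod_eigenvalues]
  calc ∏ i, (hG.1.eigenvalues i : ℝ) ≤ ∏ i, Real.exp (hG.1.eigenvalues i - 1) :=
        Finset.prod_le_prod (fun i _ => hG.eigenvalues_nonneg i) fun i _ => by
          linarith [Real.add_one_le_exp (hG.1.eigenvalues i - 1)]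
    _ = 1 := by rw [← Real.exp_sum, hsum, Real.exp_zero]

theorem charFun_map_mulVec {κ n : Type*} [Fintype κ] [Fintype n] (A : Matrix κ n ℝ)
    (t : EuclideanSpace ℝ κ) :
    charFun (((Measure.pi fun _ : n => gaussianReal 0 1).map A.mulVec).map (WithLp.toLp 2)) t =
      Complex.exp (-((t.ofLp ⬝ᵥ (A * A.transpose).mulVec t.ofLp : ℝ) : ℂ) / 2) := by
  have hm : Measurable A.mulVec := by
    change Measurable (fun v => A.mulVec v)
    unfold Matrix.mulVec dotProduct; fun_prop
  have hinner : ∀ z : n → ℝ, inner ℝ (WithLp.toLp 2 (A.mulVec z)) t =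
      inner ℝ (WithLp.toLp 2 z) (WithLp.toLp 2 (A.transpose.mulVec t.ofLp)) := by
    intro z
    simp only [EuclideanSpace.inner_eq_star_dotProduct, star_trivial]
    rw [Matrix.dotProduct_mulVec, Matrix.mulVec_transpose]
  have hnorm : ‖WithLp.toLp 2 (A.transpose.mulVec t.ofLp)‖ ^ 2 =
      t.ofLp ⬝ᵥ (A * A.transpose).mulVec t.ofLp := by
    rw [← real_inner_self_eq_norm_sq, EuclideanSpace.inner_eq_star_dotProduct, star_trivial,
      ← Matrix.mulVec_mulVec, dotProduct_comm t.ofLp]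
    conv_lhs => rw [Matrix.dotProduct_mulVec, Matrix.vecMul_transpose]
  have h := charFun_stdGaussian (E := EuclideanSpace ℝ n)
    (WithLp.toLp 2 (A.transpose.mulVec t.ofLp))
  rw [← map_pi_eq_stdGaussian, charFun_apply, integral_map (by fun_prop) (by fun_prop)] at h
  rw [Measure.map_map (by fun_prop) hm, charFun_apply,
    integral_map (((by fun_prop : Measurable (WithLp.toLp 2)).comp hm).aemeasurable)
      (by fun_prop)]
  simp only [Function.comp_apply, hinner]
  rw [h, ← hnorm]
  push_cast
  rfl

/-- The image of the standard Gaussian measure under a linear map depends only on its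
covariance matrix. -/
theorem map_mulVec_eq_of_mul_transpose_eq {κ n m : Type*} [Fintype κ] [Fintype n] [Fintype m]
    {A : Matrix κ n ℝ} {B : Matrix κ m ℝ} (h : A * A.transpose = B * B.transpose) :
    (Measure.pi fun _ : n => gaussianReal 0 1).map A.mulVec =
      (Measure.pi fun _ : m => gaussianReal 0 1).map B.mulVec := by
  have h1 : ((Measure.pi fun _ : n => gaussianReal 0 1).map A.mulVec).map (WithLp.toLp 2) =
      ((Measure.pi fun _ : m => gaussianReal 0 1).map B.mulVec).map (WithLp.toLp 2) := by
    refine Measure.ext_of_charFun (E := EuclideanSpace ℝ κ) (funext fun t => ?_)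
    rw [charFun_map_mulVec, charFun_map_mulVec, h]
  have h2 := congrArg (fun μ => μ.map (MeasurableEquiv.toLp 2 (κ → ℝ)).symm) h1
  rw [← MeasurableEquiv.coe_toLp] at h2
  simpa [MeasurableEquiv.map_symm_map] using h2

/-- If `G = 1 + E` with `G ≥ 1/2`, then `G⁻¹ ≤ 1 - E + 2 E²`. -/
theorem dotProduct_inv_mulVec_le {κ : Type*} [Fintype κ] [DecidableEq κ]
    {G : Matrix κ κ ℝ} (hG : G.IsSymm) (hlow : ∀ x, x ⬝ᵥ x ≤ 2 * (x ⬝ᵥ G.mulVec x))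
    (hu : IsUnit G.det) (a : κ → ℝ) :
    a ⬝ᵥ G⁻¹.mulVec a - a ⬝ᵥ a ≤
      -(a ⬝ᵥ (G - 1).mulVec a) + 2 * ((G - 1).mulVec a ⬝ᵥ (G - 1).mulVec a) := by
  set E := G - 1 with hE
  have hGE : G = 1 + E := by rw [hE]; abel
  have hEs : ∀ x y : κ → ℝ, x ⬝ᵥ E.mulVec y = E.mulVec x ⬝ᵥ y := by
    intro x y
    have : E.transpose = E := by rw [hE, Matrix.transpose_sub, hG.eq, Matrix.transpose_one]
    rw [Matrix.dotProduct_mulVec, ← Matrix.mulVec_transpose, this]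
  obtain ⟨b, hb⟩ : ∃ b, G.mulVec b = a :=
    ⟨G⁻¹.mulVec a, by rw [Matrix.mulVec_mulVec, Matrix.mul_nonsing_inv _ hu, Matrix.one_mulVec]⟩
  have hb' : G⁻¹.mulVec a = b := by
    rw [← hb, Matrix.mulVec_mulVec, Matrix.nonsing_inv_mul _ hu, Matrix.one_mulVec]
  rw [hb']
  have ha : a = b + E.mulVec b := by rw [← hb, hGE, Matrix.add_mulVec, Matrix.one_mulVec]
  set e := E.mulVec b with he
  -- `E a = G e`
  have hEa : E.mulVec a = G.mulVec e := by
    rw [ha, hGE, Matrix.mulVec_add, Matrix.add_mulVec, Matrix.one_mulVec]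
  have h1 : a ⬝ᵥ b = a ⬝ᵥ a - a ⬝ᵥ E.mulVec a + e ⬝ᵥ G.mulVec e := by
    rw [← hEa, hEs a a, hEs e a]
    have h2 : E.mulVec a = e + E.mulVec e := by
      rw [hEa, hGE, Matrix.add_mulVec, Matrix.one_mulVec]
    have h3 : a ⬝ᵥ e = E.mulVec a ⬝ᵥ b := by rw [he, hEs]
    have h4 : b = a - e := by rw [ha]; abel
    have h5 : a ⬝ᵥ e = E.mulVec a ⬝ᵥ a - E.mulVec a ⬝ᵥ e := by
      rw [h3]; conv_lhs => rw [h4]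
      rw [dotProduct_sub]
    have h6 : E.mulVec e ⬝ᵥ a = e ⬝ᵥ E.mulVec a := (hEs e a).symm
    rw [h6, h4, dotProduct_sub, h5, dotProduct_comm (E.mulVec a) e]
    ring
  have h2 : e ⬝ᵥ G.mulVec e ≤ 2 * (G.mulVec e ⬝ᵥ G.mulVec e) := by
    have h3 := hlow e
    have h4 : 0 ≤ (e - (2:ℝ) • G.mulVec e) ⬝ᵥ (e - (2:ℝ) • G.mulVec e) := by
      simpa using dotProduct_star_self_nonneg (e - (2:ℝ) • G.mulVec e)
    simp only [dotProduct_sub, sub_dotProduct, smul_dotProduct, dotProduct_smul, smul_eq_mul,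
      dotProduct_comm (G.mulVec e) e] at h4
    linarith
  rw [hEa] at *
  linarith

/-- The correlation of the response at `v` with the other responses in `S`. -/
def crossSum {ι : Type*} [DecidableEq ι] (K : ι → ι → ℝ) (S : Finset ι) (a : ι → ℝ) (v : ι) : ℝ :=
  ∑ w ∈ S.erase v, K v w * a w

/-- The off-diagonal part of the quadratic form `K`, halved, on the coordinates in `S`. -/
noncomputable def crossForm {ι : Type*} [DecidableEq ι] (K : ι → ι → ℝ) (S : Finset ι)
    (a : ι → ℝ) : ℝ :=
  (∑ v ∈ S, a v * crossSum K S a v) / 2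

theorem dotProduct_self_le_two_mul_gram {κ : Type*} [Fintype κ] [DecidableEq κ] {N : ℕ}
    (u : κ → EuclideanSpace ℝ (Fin N)) {ε : ℝ} (h1 : ∀ i, ‖u i‖ = 1)
    (hε : ∀ i j, i ≠ j → |inner ℝ (u i) (u j)| ≤ ε) (hε0 : 0 ≤ ε)
    (hk : Fintype.card κ * ε ≤ 1 / 2) (x : κ → ℝ) :
    x ⬝ᵥ x ≤ 2 * (x ⬝ᵥ (Matrix.gram ℝ u).mulVec x) := by
  have hentry : ∀ i j, -(ε * ((x i ^ 2 + x j ^ 2) / 2)) ≤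
      x i * ((Matrix.gram ℝ u - 1) i j * x j) := by
    intro i j
    have hx : |x i * x j| ≤ (x i ^ 2 + x j ^ 2) / 2 := by
      rw [abs_le]; constructor <;> nlinarith [sq_nonneg (x i + x j), sq_nonneg (x i - x j)]
    have hE : |(Matrix.gram ℝ u - 1) i j| ≤ ε := by
      by_cases h : i = j
      · subst h; simp [Matrix.gram_apply, h1, hε0]
      · simpa [Matrix.gram_apply, Matrix.one_apply_ne h] using hε i j h
    have : |x i * ((Matrix.gram ℝ u - 1) i j * x j)| ≤ ε * ((x i ^ 2 + x j ^ 2) / 2) := by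
      rw [mul_left_comm, abs_mul]
      exact mul_le_mul hE hx (abs_nonneg _) hε0
    linarith [neg_abs_le (x i * ((Matrix.gram ℝ u - 1) i j * x j))]
  have hsum : -(ε * (Fintype.card κ * (x ⬝ᵥ x))) ≤ x ⬝ᵥ (Matrix.gram ℝ u - 1).mulVec x := by
    calc -(ε * (Fintype.card κ * (x ⬝ᵥ x)))
        = ∑ i, ∑ j, -(ε * ((x i ^ 2 + x j ^ 2) / 2)) := by
          simp only [Finset.sum_neg_distrib, ← Finset.mul_sum, ← Finset.sum_div,
            Finset.sum_add_distrib, Finset.sum_const, Finset.card_univ, nsmul_eq_mul, dotProduct,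
            ← sq]
          ring
      _ ≤ ∑ i, ∑ j, x i * ((Matrix.gram ℝ u - 1) i j * x j) :=
          Finset.sum_le_sum fun i _ => Finset.sum_le_sum fun j _ => hentry i j
      _ = _ := by simp only [dotProduct, Matrix.mulVec, Finset.mul_sum]
  have hx0 : 0 ≤ x ⬝ᵥ x := by simpa using dotProduct_star_self_nonneg x
  rw [Matrix.sub_mulVec, Matrix.one_mulVec, dotProduct_sub] at hsum
  nlinarith [mul_le_mul_of_nonneg_right hk hx0]

open scoped MatrixOrder in
/-- The law of the inner products with nearly orthonormal vectors is bounded below by the standard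
Gaussian law up to an error given by the off-diagonal inner products. -/
theorem pi_gaussianReal_le_map_inner_add {κ : Type*} [Fintype κ] [DecidableEq κ] {N : ℕ}
    (u : κ → EuclideanSpace ℝ (Fin N)) {ε : ℝ} (h1 : ∀ i, ‖u i‖ = 1)
    (hε : ∀ i j, i ≠ j → |inner ℝ (u i) (u j)| ≤ ε) (hε0 : 0 ≤ ε)
    (hk : Fintype.card κ * ε ≤ 1 / 2) {C : Set (κ → ℝ)} (hC : MeasurableSet C) :
    (Measure.pi fun _ : κ => gaussianReal 0 1) C ≤
      ((Measure.pi fun _ : Fin N => gaussianReal 0 1).map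
        (fun Ψ i => inner ℝ (WithLp.toLp 2 Ψ) (u i))) C +
      ∫⁻ a in C, ENNReal.ofReal
        (|crossForm (fun i j => inner ℝ (u i) (u j)) Finset.univ a| +
          ∑ v, crossSum (fun i j => inner ℝ (u i) (u j)) Finset.univ a v ^ 2)
        ∂(Measure.pi fun _ : κ => gaussianReal 0 1) := by
  set G := Matrix.gram ℝ u with hG
  have hpsd : G.PosSemidef := Matrix.posSemidef_gram ℝ u
  have hlow := dotProduct_self_le_two_mul_gram u h1 hε hε0 hk
  have hdet : G.det ≠ 0 := by
    intro h0
    obtain ⟨x, hx, hGx⟩ := Matrix.exists_mulVec_eq_zero_iff.2 h0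
    have := hlow x
    rw [← hG, hGx, dotProduct_zero, mul_zero] at this
    exact hx (dotProduct_self_eq_zero.1 (le_antisymm this
      (by simpa using dotProduct_star_self_nonneg x)))
  set R := CFC.sqrt G with hRdef
  have hRR : R * R = G := CFC.sqrt_mul_sqrt_self _ hpsd.nonneg
  have hRs : R.transpose = R := by
    have := (Matrix.nonneg_iff_posSemidef.1 (CFC.sqrt_nonneg G)).1
    simpa [Matrix.IsHermitian, Matrix.conjTranspose_eq_transpose_of_trivial] using this
  have hdetR : R.det * R.det = G.det := by rw [← Matrix.det_mul, hRR]
  have hR0 : R.det ≠ 0 := fun h => hdet (by rw [← hdetR, h, mul_zero])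
  have hG1 : G.det ≤ 1 := hpsd.det_le_one_of_diag_eq_one fun i => by simp [hG, h1]
  have hR1 : |R.det| ≤ 1 := by
    rw [← hdetR, ← sq] at hG1
    exact (sq_le_one_iff_abs_le_one _).1 hG1
  have hlaw : (Measure.pi fun _ : Fin N => gaussianReal 0 1).map
        (fun Ψ i => inner ℝ (WithLp.toLp 2 Ψ) (u i)) =
      (Measure.pi fun _ : κ => gaussianReal 0 1).map R.mulVec := by
    rw [← map_mulVec_eq_of_mul_transpose_eq (A := Matrix.of fun i j => u i j) (B := R)]
    · rfl
    · rw [hRs, hRR]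
      ext i j
      simp [hG, Matrix.mul_apply, PiLp.inner_apply, mul_comm]
  have hquad : ∀ a, R⁻¹.mulVec a ⬝ᵥ R⁻¹.mulVec a = a ⬝ᵥ G⁻¹.mulVec a := by
    intro a
    rw [← hRR, Matrix.mul_inv_rev, ← Matrix.mulVec_mulVec, Matrix.dotProduct_mulVec a,
      ← Matrix.mulVec_transpose, Matrix.transpose_nonsing_inv, hRs]
  have hE : ∀ a v, (G - 1).mulVec a v =
      crossSum (fun i j => inner ℝ (u i) (u j)) Finset.univ a v := by
    intro a v
    rw [crossSum, Matrix.mulVec, dotProduct, ← Finset.add_sum_erase _ _ (Finset.mem_univ v)]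
    simp only [Matrix.sub_apply, hG, Matrix.gram_apply, real_inner_self_eq_norm_sq, h1,
      Matrix.one_apply_eq]
    rw [one_pow, sub_self, zero_mul, zero_add]
    refine Finset.sum_congr rfl fun w hw => ?_
    rw [Matrix.one_apply_ne (Finset.ne_of_mem_erase hw).symm, sub_zero]
  have hsymm : G.IsSymm := by
    simpa [Matrix.IsHermitian, Matrix.IsSymm, Matrix.conjTranspose_eq_transpose_of_trivial]
      using hpsd.1
  have hW : ∀ a, 1 - Real.exp (-((R⁻¹.mulVec a) ⬝ᵥ (R⁻¹.mulVec a) - a ⬝ᵥ a) / 2) ≤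
      |crossForm (fun i j => inner ℝ (u i) (u j)) Finset.univ a| +
          ∑ v, crossSum (fun i j => inner ℝ (u i) (u j)) Finset.univ a v ^ 2 := by
    intro a
    have h := dotProduct_inv_mulVec_le hsymm hlow hdet.isUnit a
    have h2 := Real.add_one_le_exp (-((R⁻¹.mulVec a) ⬝ᵥ (R⁻¹.mulVec a) - a ⬝ᵥ a) / 2)
    rw [hquad] at h2 ⊢
    have h3 : a ⬝ᵥ (G - 1).mulVec a =
        2 * crossForm (fun i j => inner ℝ (u i) (u j)) Finset.univ a := by
      rw [crossForm, dotProduct]; simp only [hE]; ring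
    have h4 : (G - 1).mulVec a ⬝ᵥ (G - 1).mulVec a =
        ∑ v, crossSum (fun i j => inner ℝ (u i) (u j)) Finset.univ a v ^ 2 := by
      rw [dotProduct]; simp only [hE, sq]
    rw [h3, h4] at h
    linarith [neg_abs_le (crossForm (fun i j => inner ℝ (u i) (u j)) Finset.univ a)]
  have hmeas : Measurable fun a : κ → ℝ => ENNReal.ofReal
        (Real.exp (-((R⁻¹.mulVec a) ⬝ᵥ (R⁻¹.mulVec a) - a ⬝ᵥ a) / 2)) := by
    unfold Matrix.mulVec dotProduct; fun_prop
  rw [hlaw]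
  refine le_trans ?_ (add_le_add_left (setLIntegral_exp_le_map_mulVec hR0 hR1 hC) _)
  rw [← lintegral_add_left hmeas, ← setLIntegral_one]
  refine lintegral_mono fun a => ?_
  rw [← ENNReal.ofReal_one, ← ENNReal.ofReal_add (Real.exp_pos _).le (by positivity)]
  exact ENNReal.ofReal_le_ofReal (by linarith [hW a])

theorem measurableSingletonClass_sum (α β : Type*) [MeasurableSpace α] [MeasurableSpace β]
    [MeasurableSingletonClass α] [MeasurableSingletonClass β] :
    MeasurableSingletonClass (α ⊕ β) where
  measurableSet_singleton := by
    rintro (x | y)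
    · rw [← Set.image_singleton]; exact (measurableSet_singleton x).inl_image
    · rw [← Set.image_singleton]; exact (measurableSet_singleton y).inr_image

attribute [local instance] measurableSingletonClass_sum

namespace QueryAlgorithm

section

variable {ι Ω : Type*} [MeasurableSpace ι] [MeasurableSpace Ω]

theorem snd_eq_of_mem_history (A : QueryAlgorithm ι Ω) (ω : Ω) (a : ι → ℝ) (k : ℕ) :
    ∀ p ∈ A.history ω a k, p = (p.1, a p.1) := by
  induction k with
  | zero => simp [history]
  | succ k ih =>
    rw [history]
    split
    · intro p hp
      rcases List.mem_append.1 hp with hp | hp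
      · exact ih p hp
      · rw [List.mem_singleton.1 hp]
    · exact ih

theorem history_eq_map (A : QueryAlgorithm ι Ω) (ω : Ω) (a : ι → ℝ) (k : ℕ) :
    ((A.history ω a k).map Prod.fst).map (fun v => (v, a v)) = A.history ω a k := by
  rw [List.map_map]
  conv_rhs => rw [← List.map_id (A.history ω a k)]
  exact List.map_congr_left fun p hp => (A.snd_eq_of_mem_history ω a k p hp).symm

theorem history_congr (A : QueryAlgorithm ι Ω) (ω : Ω) {a b : ι → ℝ} {k : ℕ}
    (h : ∀ v ∈ (A.history ω a k).map Prod.fst, a v = b v) :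
    A.history ω b k = A.history ω a k := by
  induction k with
  | zero => rfl
  | succ k ih =>
    have hk : A.history ω b k = A.history ω a k := by
      refine ih fun v hv => h v ?_
      rw [history]
      split
      · rw [List.map_append]; exact List.mem_append_left _ hv
      · exact hv
    rw [history, history, hk]
    cases hm : A.move ω (A.history ω a k) with
    | inl v =>
      have := h v (by rw [history, hm]; simp)
      simp [this]
    | inr b => rfl

theorem length_history_le (A : QueryAlgorithm ι Ω) (ω : Ω) (a : ι → ℝ) (k : ℕ) :
    (A.history ω a k).length ≤ k := by
  induction k with
  | zero => simp [history]
  | succ k ih =>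
    rw [history]
    split
    · simpa using ih
    · omega

theorem length_history_mono (A : QueryAlgorithm ι Ω) (ω : Ω) (a : ι → ℝ) :
    Monotone fun k => (A.history ω a k).length := by
  refine monotone_nat_of_le_succ fun k => ?_
  rw [history]
  split <;> simp

theorem history_eq_of_move_eq_inr (A : QueryAlgorithm ι Ω) {ω : Ω} {a : ι → ℝ} {k : ℕ} {b : Bool}
    (h : A.move ω (A.history ω a k) = Sum.inr b) (j : ℕ) :
    A.history ω a (k + j) = A.history ω a k := by
  induction j with
  | zero => rfl
  | succ j ih => rw [← add_assoc, history, ih, h]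

theorem measurable_move_map (A : QueryAlgorithm ι Ω) (s : List ι) :
    Measurable fun p : Ω × (ι → ℝ) => A.move p.1 (s.map fun v => (v, p.2 v)) := by
  have h : ∀ a : ι → ℝ, s.map (fun v => (v, a v)) =
      List.ofFn fun i : Fin s.length => (s[i], a s[i]) := by
    intro a
    conv_lhs => rw [← List.ofFn_getElem (xs := s), List.map_ofFn]
    rfl
  simp only [h]
  exact (A.measurable_move s.length).comp
    (f := fun p : Ω × (ι → ℝ) => (p.1, fun i : Fin s.length => (s[i], p.2 s[i]))) (by fun_prop)

variable [Finite ι]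

theorem measurable_comp_history_of_measurableSet (A : QueryAlgorithm ι Ω) {β : Type*}
    [MeasurableSpace β] {k : ℕ}
    (hk : ∀ s, MeasurableSet {p : Ω × (ι → ℝ) | (A.history p.1 p.2 k).map Prod.fst = s})
    {Φ : Ω × (ι → ℝ) → List (ι × ℝ) → β}
    (hΦ : ∀ s : List ι, Measurable fun p : Ω × (ι → ℝ) => Φ p (s.map fun v => (v, p.2 v))) :
    Measurable fun p : Ω × (ι → ℝ) => Φ p (A.history p.1 p.2 k) := by
  intro t ht
  have : (fun p : Ω × (ι → ℝ) => Φ p (A.history p.1 p.2 k)) ⁻¹' t =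
      ⋃ s : List ι, {p | (A.history p.1 p.2 k).map Prod.fst = s} ∩
        (fun p => Φ p (s.map fun v => (v, p.2 v))) ⁻¹' t := by
    ext p
    simp only [Set.mem_preimage, Set.mem_iUnion, Set.mem_inter_iff, Set.mem_ofPred_eq,
      exists_eq_left', history_eq_map]
  rw [this]
  exact MeasurableSet.iUnion fun s => (hk s).inter (hΦ s ht)

variable [MeasurableSingletonClass ι]

theorem measurableSet_history_map_fst_eq (A : QueryAlgorithm ι Ω) (k : ℕ) :
    ∀ s, MeasurableSet {p : Ω × (ι → ℝ) | (A.history p.1 p.2 k).map Prod.fst = s} := by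
  induction k with
  | zero => intro s; simp [history]
  | succ k ih =>
    intro s
    let next : ι ⊕ Bool → List ι → Prop := fun m l => (match m with
      | Sum.inl v => l ++ [v]
      | Sum.inr _ => l) = s
    have hm := A.measurable_comp_history_of_measurableSet (β := Prop) ih
      (Φ := fun p h => next (A.move p.1 h) (h.map Prod.fst)) (fun l => by
        have : ∀ p : Ω × (ι → ℝ), (l.map fun v => (v, p.2 v)).map Prod.fst = l := by
          intro p; simp [List.map_map, Function.comp_def]
        simp only [this]
        exact (measurable_of_countable fun m => next m l).comp (A.measurable_move_map l))
    have h2 := measurableSet_setOfPred.2 hm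
    convert h2 using 3 with p
    simp only [next]
    rw [history]
    split <;> simp_all

theorem measurable_comp_history (A : QueryAlgorithm ι Ω) {β : Type*} [MeasurableSpace β] (k : ℕ)
    {Φ : Ω × (ι → ℝ) → List (ι × ℝ) → β}
    (hΦ : ∀ s : List ι, Measurable fun p : Ω × (ι → ℝ) => Φ p (s.map fun v => (v, p.2 v))) :
    Measurable fun p : Ω × (ι → ℝ) => Φ p (A.history p.1 p.2 k) :=
  A.measurable_comp_history_of_measurableSet (A.measurableSet_history_map_fst_eq k) hΦ

theorem measurable_move_history (A : QueryAlgorithm ι Ω) (k : ℕ) :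
    Measurable fun p : Ω × (ι → ℝ) => A.move p.1 (A.history p.1 p.2 k) :=
  A.measurable_comp_history k (Φ := fun p h => A.move p.1 h) A.measurable_move_map

theorem measurable_length_history (A : QueryAlgorithm ι Ω) (k : ℕ) :
    Measurable fun p : Ω × (ι → ℝ) => (A.history p.1 p.2 k).length :=
  A.measurable_comp_history k (Φ := fun _ h => h.length) fun s => by simp

end

/-- The set of test vectors queried in the first `k` steps. -/
def queried {ι Ω : Type*} [MeasurableSpace ι] [MeasurableSpace Ω] [DecidableEq ι]
    (A : QueryAlgorithm ι Ω) (ω : Ω) (a : ι → ℝ) (k : ℕ) : Finset ι :=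
  ((A.history ω a k).map Prod.fst).toFinset

section

variable {ι Ω : Type*} [MeasurableSpace ι] [MeasurableSpace Ω] [DecidableEq ι]

theorem history_congr_of_queried (A : QueryAlgorithm ι Ω) (ω : Ω) {a b : ι → ℝ} {k : ℕ}
    (h : ∀ v ∈ A.queried ω a k, a v = b v) :
    A.history ω b k = A.history ω a k :=
  A.history_congr ω fun v hv => h v (List.mem_toFinset.2 hv)

theorem queried_congr (A : QueryAlgorithm ι Ω) (ω : Ω) {a b : ι → ℝ} {k : ℕ}
    (h : ∀ v ∈ A.queried ω a k, a v = b v) :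
    A.queried ω b k = A.queried ω a k := by
  rw [queried, A.history_congr_of_queried ω h, queried]

theorem card_queried_le (A : QueryAlgorithm ι Ω) (ω : Ω) (a : ι → ℝ) (k : ℕ) :
    (A.queried ω a k).card ≤ k :=
  (List.toFinset_card_le _).trans (by simpa using A.length_history_le ω a k)

theorem queried_succ (A : QueryAlgorithm ι Ω) (ω : Ω) (a : ι → ℝ) (k : ℕ) :
    A.queried ω a (k + 1) =
      match A.move ω (A.history ω a k) with
      | Sum.inl v => insert v (A.queried ω a k)
      | Sum.inr _ => A.queried ω a k := by
  rw [queried, history]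
  cases A.move ω (A.history ω a k) with
  | inl v => ext; simp [queried]
  | inr b => rfl

theorem notMem_queried (A : QueryAlgorithm ι Ω) {ω : Ω} {a : ι → ℝ} {k : ℕ} {v : ι}
    (h : A.move ω (A.history ω a k) = Sum.inl v) : v ∉ A.queried ω a k := fun hv =>
  A.fresh _ _ _ h (List.mem_toFinset.1 hv)

theorem history_update (A : QueryAlgorithm ι Ω) {ω : Ω} {a : ι → ℝ} {k : ℕ} {v : ι}
    (h : v ∉ A.queried ω a k) (x : ℝ) :
    A.history ω (Function.update a v x) k = A.history ω a k :=
  A.history_congr_of_queried ω fun w hw => by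
    rw [Function.update_of_ne]
    rintro rfl
    exact h hw

theorem move_history_update_iff (A : QueryAlgorithm ι Ω) {ω : Ω} {a : ι → ℝ} {k : ℕ} {v : ι}
    (x : ℝ) :
    A.move ω (A.history ω (Function.update a v x) k) = Sum.inl v ↔
      A.move ω (A.history ω a k) = Sum.inl v := by
  constructor
  · intro h
    have h2 := A.history_update (A.notMem_queried h) (a v)
    rw [Function.update_idem, Function.update_eq_self] at h2
    rwa [h2]
  · intro h
    rwa [A.history_update (A.notMem_queried h) x]

variable [Finite ι] [MeasurableSingletonClass ι]

theorem measurable_comp_queried (A : QueryAlgorithm ι Ω) {β : Type*} [MeasurableSpace β] (k : ℕ)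
    {F : Finset ι → (ι → ℝ) → β} (hF : ∀ S, Measurable (F S)) :
    Measurable fun p : Ω × (ι → ℝ) => F (A.queried p.1 p.2 k) p.2 :=
  A.measurable_comp_history k (Φ := fun p h => F (h.map Prod.fst).toFinset p.2) fun s => by
    simp only [List.map_map, Function.comp_def, List.map_id']
    exact (hF _).comp measurable_snd

end

end QueryAlgorithm

/-- Resampling one coordinate does not change an integral against a product measure. -/
theorem lintegral_pi_eq_lintegral_update {ι : Type*} [Fintype ι] [DecidableEq ι]
    (μ : Measure ℝ) [IsProbabilityMeasure μ] {f : (ι → ℝ) → ENNReal} (hf : Measurable f) (i : ι) :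
    ∫⁻ a, f a ∂(Measure.pi fun _ => μ) =
      ∫⁻ a, ∫⁻ x, f (Function.update a i x) ∂μ ∂(Measure.pi fun _ => μ) := by
  have hg : Measurable fun a : ι → ℝ => ∫⁻ x, f (Function.update a i x) ∂μ :=
    Measurable.lintegral_prod_right (f := fun a x => f (Function.update a i x))
      (hf.comp measurable_update')
  rw [lintegral_eq_lmarginal_univ (μ := fun _ : ι => μ) (f := f) 0,
    lintegral_eq_lmarginal_univ (μ := fun _ : ι => μ) 0,
    lmarginal_erase' _ hf (Finset.mem_univ i), lmarginal_erase' _ hg (Finset.mem_univ i)]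
  simp

/-- One step of an adaptive algorithm whose responses are independent: if resampling the new
response takes `F` below `G`, then it does so along the run. -/
theorem QueryAlgorithm.lintegral_queried_succ_le {ι Ω : Type*} [MeasurableSpace ι]
    [MeasurableSpace Ω] [Fintype ι] [DecidableEq ι] [MeasurableSingletonClass ι]
    (A : QueryAlgorithm ι Ω) (ω : Ω) (μ : Measure ℝ) [IsProbabilityMeasure μ]
    {F G : Finset ι → (ι → ℝ) → ENNReal} (hF : ∀ S, Measurable (F S)) (hG : ∀ S, Measurable (G S))
    (h1 : ∀ S a, ∀ w ∉ S, ∫⁻ x, F (insert w S) (Function.update a w x) ∂μ ≤ G S a)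
    (h2 : ∀ S a, F S a ≤ G S a) (k : ℕ) :
    ∫⁻ a, F (A.queried ω a (k + 1)) a ∂(Measure.pi fun _ => μ) ≤
      ∫⁻ a, G (A.queried ω a k) a ∂(Measure.pi fun _ => μ) := by
  have hω : Measurable fun a : ι → ℝ => (ω, a) := measurable_prodMk_left
  have hmove : Measurable fun a => A.move ω (A.history ω a k) :=
    (A.measurable_move_history k).comp hω
  have hmF : ∀ m, Measurable fun a => F (A.queried ω a m) a :=
    fun m => (A.measurable_comp_queried m hF).comp hω
  have hmG : Measurable fun a => G (A.queried ω a k) a :=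
    (A.measurable_comp_queried k hG).comp hω
  let E : ι ⊕ Bool → Set (ι → ℝ) := fun m => {a | A.move ω (A.history ω a k) = m}
  have hE : ∀ m, MeasurableSet (E m) := fun m => hmove (measurableSet_singleton m)
  have hsplit : ∀ f : (ι → ℝ) → ENNReal, Measurable f →
      ∫⁻ a, f a ∂(Measure.pi fun _ => μ) =
        ∑ m, ∫⁻ a, (E m).indicator f a ∂(Measure.pi fun _ => μ) := by
    intro f hf
    rw [← lintegral_finsetSum _ fun m _ => hf.indicator (hE m)]
    refine lintegral_congr fun a => ?_
    rw [Finset.sum_eq_single (A.move ω (A.history ω a k))]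
    · exact (Set.indicator_of_mem (show a ∈ E _ from rfl) f).symm
    · intro m _ hm
      exact Set.indicator_of_notMem (show a ∉ E m from fun h => hm (Eq.symm h)) f
    · simp
  rw [hsplit _ (hmF (k + 1)), hsplit _ hmG]
  refine Finset.sum_le_sum fun m _ => ?_
  cases m with
  | inr b =>
    refine lintegral_mono fun a => ?_
    by_cases ha : a ∈ E (Sum.inr b)
    · rw [Set.indicator_of_mem ha, Set.indicator_of_mem ha, A.queried_succ, show _ = _ from ha]
      exact h2 _ _
    · rw [Set.indicator_of_notMem ha]
      exact zero_le
  | inl w =>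
    rw [lintegral_pi_eq_lintegral_update μ ((hmF (k + 1)).indicator (hE _)) w]
    refine lintegral_mono fun a => ?_
    by_cases ha : a ∈ E (Sum.inl w)
    · have hx : ∀ x, Function.update a w x ∈ E (Sum.inl w) := fun x =>
        (A.move_history_update_iff x).2 ha
      have hw := A.notMem_queried ha
      rw [Set.indicator_of_mem ha]
      refine le_trans (le_of_eq (lintegral_congr fun x => ?_)) (h1 _ a w hw)
      rw [Set.indicator_of_mem (hx x), A.queried_succ, show _ = _ from hx x, queried,
        A.history_update hw x, queried]
    · have hx : ∀ x, Function.update a w x ∉ E (Sum.inl w) := fun x hx =>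
        ha ((A.move_history_update_iff x).1 hx)
      simp [Set.indicator_of_notMem (hx _)]

theorem lintegral_exp_mul_gaussianReal (c t : ℝ) :
    ∫⁻ x, ENNReal.ofReal (Real.exp (c + t * x)) ∂(gaussianReal 0 1) =
      ENNReal.ofReal (Real.exp (c + t ^ 2 / 2)) := by
  have h := mgf_gaussianReal (p := gaussianReal 0 1) (X := id) (μ := 0) (v := 1) (by simp) t
  rw [mgf] at h
  simp only [Real.exp_add, id_eq, zero_mul, NNReal.coe_one, one_mul, zero_add] at h ⊢
  rw [← ofReal_integral_eq_lintegral_ofReal ((integrable_exp_mul_gaussianReal t).const_mul _)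
    (Filter.Eventually.of_forall fun x => by positivity), integral_const_mul, h]

theorem lintegral_sq_add_mul_gaussianReal (z y : ℝ) :
    ∫⁻ x, ENNReal.ofReal ((z + y * x) ^ 2) ∂(gaussianReal 0 1) = ENNReal.ofReal (z ^ 2 + y ^ 2) := by
  have h1 : ∫ x, x ∂(gaussianReal 0 1) = 0 := integral_id_gaussianReal
  have h2 : ∫ x, x ^ 2 ∂(gaussianReal 0 1) = 1 := by
    have h := variance_id_gaussianReal (μ := 0) (v := 1)
    rw [variance_of_integral_eq_zero (by fun_prop) (by simp)] at h
    simpa using h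
  have i1 : Integrable (fun x : ℝ => x) (gaussianReal 0 1) :=
    (memLp_id_gaussianReal 1).integrable le_rfl
  have i2 : Integrable (fun x : ℝ => x ^ 2) (gaussianReal 0 1) :=
    (memLp_id_gaussianReal 2).integrable_sq
  have e : ∀ x : ℝ, (z + y * x) ^ 2 = z ^ 2 + 2 * z * y * x + y ^ 2 * x ^ 2 := fun x => by ring
  simp only [e]
  have i3 : Integrable (fun x : ℝ => z ^ 2 + 2 * z * y * x) (gaussianReal 0 1) :=
    (integrable_const _).add (i1.const_mul _)
  rw [← ofReal_integral_eq_lintegral_ofReal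
    (show Integrable (fun x : ℝ => z ^ 2 + 2 * z * y * x + y ^ 2 * x ^ 2) (gaussianReal 0 1) from
      i3.add (i2.const_mul _))
    (Filter.Eventually.of_forall fun x => by
      show (0:ℝ) ≤ z ^ 2 + 2 * z * y * x + y ^ 2 * x ^ 2
      rw [← e]; positivity)]
  congr 1
  rw [integral_add i3 (i2.const_mul _), integral_add (integrable_const _) (i1.const_mul _),
    integral_const_mul, integral_const_mul, h1, h2]
  simp

section

variable {ι : Type*} [DecidableEq ι] {K : ι → ι → ℝ}

theorem crossSum_insert_update {S : Finset ι} {w : ι} (hw : w ∉ S) (a : ι → ℝ) (x : ℝ) (v : ι) :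
    crossSum K (insert w S) (Function.update a w x) v =
      crossSum K S a v + (if w = v then 0 else K v w) * x := by
  have hS : ∑ u ∈ S.erase v, K v u * Function.update a w x u = ∑ u ∈ S.erase v, K v u * a u :=
    Finset.sum_congr rfl fun u hu => by
      rw [Function.update_of_ne]
      rintro rfl
      exact hw (Finset.mem_of_mem_erase hu)
  unfold crossSum
  split_ifs with h
  · subst h
    rw [Finset.erase_insert hw, zero_mul, add_zero, ← hS, Finset.erase_eq_of_notMem hw]
  · rw [Finset.erase_insert_of_ne h, Finset.sum_insert
      (fun h => hw (Finset.mem_of_mem_erase h)), hS, Function.update_self, add_comm]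

theorem crossForm_insert_update (hK : ∀ v w, K v w = K w v) {S : Finset ι} {w : ι} (hw : w ∉ S)
    (a : ι → ℝ) (x : ℝ) :
    crossForm K (insert w S) (Function.update a w x) =
      crossForm K S a + crossSum K S a w * x := by
  unfold crossForm
  rw [Finset.sum_insert hw, Function.update_self, crossSum_insert_update hw, if_pos rfl]
  have h : ∀ v ∈ S, Function.update a w x v * crossSum K (insert w S) (Function.update a w x) v =
      a v * crossSum K S a v + K w v * a v * x := by
    intro v hv
    have hvw : w ≠ v := fun h => hw (h ▸ hv)
    rw [crossSum_insert_update hw, if_neg hvw, Function.update_of_ne hvw.symm, hK v w]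
    ring
  rw [Finset.sum_congr rfl h, Finset.sum_add_distrib, ← Finset.sum_mul]
  have h2 : crossSum K S a w = ∑ v ∈ S, K w v * a v := by
    rw [crossSum, Finset.erase_eq_of_notMem hw]
  rw [h2]
  ring

@[fun_prop]
theorem measurable_crossSum (S : Finset ι) (v : ι) : Measurable fun a => crossSum K S a v := by
  unfold crossSum; fun_prop

@[fun_prop]
theorem measurable_crossForm (S : Finset ι) : Measurable fun a => crossForm K S a := by
  unfold crossForm; fun_prop

end

namespace QueryAlgorithm

variable {ι Ω : Type*} [MeasurableSpace ι] [MeasurableSpace Ω] [Fintype ι] [DecidableEq ι]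
  [MeasurableSingletonClass ι] {K : ι → ι → ℝ} {ε : ℝ}

theorem measurable_queried (A : QueryAlgorithm ι Ω) (ω : Ω) (k : ℕ)
    {F : Finset ι → (ι → ℝ) → ENNReal} (hF : ∀ S, Measurable (F S)) :
    Measurable fun a => F (A.queried ω a k) a :=
  (A.measurable_comp_queried k hF).comp measurable_prodMk_left

theorem lintegral_exp_crossSum_le (A : QueryAlgorithm ι Ω) (ω : Ω)
    (hε : ∀ v w, v ≠ w → |K v w| ≤ ε) (s : ℝ) (v : ι) (k : ℕ) :
    ∫⁻ a, ENNReal.ofReal (Real.exp (s * crossSum K (A.queried ω a k) a v))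
        ∂(Measure.pi fun _ => gaussianReal 0 1) ≤
      ENNReal.ofReal (Real.exp (k * (s ^ 2 * ε ^ 2 / 2))) := by
  induction k with
  | zero => simp [queried, history, crossSum]
  | succ k ih =>
    set c := s ^ 2 * ε ^ 2 / 2 with hc
    have hc0 : 0 ≤ c := by positivity
    refine (A.lintegral_queried_succ_le ω (gaussianReal 0 1)
      (F := fun S a => ENNReal.ofReal (Real.exp (s * crossSum K S a v)))
      (G := fun S a => ENNReal.ofReal (Real.exp c) *
        ENNReal.ofReal (Real.exp (s * crossSum K S a v)))
      (fun S => by fun_prop) (fun S => by fun_prop) ?_ ?_ k).trans ?_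
    · intro S a w hw
      simp only [crossSum_insert_update hw, mul_add, ← mul_assoc]
      rw [lintegral_exp_mul_gaussianReal, ← ENNReal.ofReal_mul (Real.exp_pos _).le, ← Real.exp_add]
      refine ENNReal.ofReal_le_ofReal (Real.exp_le_exp.2 ?_)
      have : (if w = v then 0 else K v w) ^ 2 ≤ ε ^ 2 := by
        split_ifs with h
        · simpa using sq_nonneg ε
        · exact sq_le_sq' (abs_le.1 (hε v w (Ne.symm h))).1 (abs_le.1 (hε v w (Ne.symm h))).2
      rw [mul_pow, hc]
      nlinarith [mul_le_mul_of_nonneg_left this (sq_nonneg s)]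
    · intro S a
      refine le_mul_of_one_le_left zero_le ?_
      rw [ENNReal.one_le_ofReal]
      exact Real.one_le_exp hc0
    · rw [lintegral_const_mul' _ _ ENNReal.ofReal_ne_top]
      refine (mul_le_mul_right ih _).trans (le_of_eq ?_)
      rw [← ENNReal.ofReal_mul (Real.exp_pos _).le, ← Real.exp_add]
      push_cast
      ring_nf

end QueryAlgorithm

/-- An exponential majorant of the squares of all `crossSum K S a v`. -/
noncomputable def crossBound {ι : Type*} [Fintype ι] [DecidableEq ι] (K : ι → ι → ℝ) (b L : ℝ)
    (S : Finset ι) (a : ι → ℝ) : ℝ :=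
  b ^ 2 * (4 * L ^ 2 + 8 * Real.exp (-L) *
    ∑ v, (Real.exp (b⁻¹ * crossSum K S a v) + Real.exp (-b⁻¹ * crossSum K S a v)))

theorem sq_le_of_exp {u L : ℝ} (hL : 0 ≤ L) :
    u ^ 2 ≤ 4 * L ^ 2 + 8 * Real.exp (-L) * (Real.exp u + Real.exp (-u)) := by
  have key : ∀ y : ℝ, 0 ≤ y → y ^ 2 ≤ 4 * L ^ 2 + 8 * Real.exp (-L) * Real.exp y := by
    intro y hy
    by_cases h : y ≤ 2 * L
    · have : 0 ≤ 8 * Real.exp (-L) * Real.exp y := by positivity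
      nlinarith
    · have h1 := Real.quadratic_le_exp_of_nonneg (x := y / 2) (by positivity)
      have h2 : Real.exp (y / 2) ≤ Real.exp (-L) * Real.exp y := by
        rw [← Real.exp_add]; exact Real.exp_le_exp.2 (by linarith)
      nlinarith [sq_nonneg L]
  have hp : 0 < Real.exp (-L) := Real.exp_pos _
  rcases le_total 0 u with h | h
  · have := key u h
    have : 0 ≤ Real.exp (-L) * Real.exp (-u) := by positivity
    nlinarith
  · have := key (-u) (by linarith)
    have : 0 ≤ Real.exp (-L) * Real.exp u := by positivity
    nlinarith

section

variable {ι : Type*} [Fintype ι] [DecidableEq ι] {K : ι → ι → ℝ} {b L : ℝ}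

@[fun_prop]
theorem measurable_crossBound (S : Finset ι) : Measurable fun a => crossBound K b L S a := by
  unfold crossBound; fun_prop

theorem crossBound_nonneg (S : Finset ι) (a : ι → ℝ) : 0 ≤ crossBound K b L S a := by
  unfold crossBound; positivity

theorem sq_crossSum_le_crossBound (hb : 0 < b) (hL : 0 ≤ L) (S : Finset ι) (a : ι → ℝ) (v : ι) :
    crossSum K S a v ^ 2 ≤ crossBound K b L S a := by
  have h := sq_le_of_exp (u := b⁻¹ * crossSum K S a v) hL
  rw [mul_pow, inv_pow, inv_mul_le_iff₀ (by positivity)] at h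
  refine h.trans ?_
  unfold crossBound
  rw [← neg_mul]
  gcongr
  exact Finset.single_le_sum (f := fun v => Real.exp (b⁻¹ * crossSum K S a v) +
    Real.exp (-b⁻¹ * crossSum K S a v)) (fun _ _ => by positivity) (Finset.mem_univ v)

end

namespace QueryAlgorithm

variable {ι Ω : Type*} [MeasurableSpace ι] [MeasurableSpace Ω] [Fintype ι] [DecidableEq ι]
  [MeasurableSingletonClass ι] {K : ι → ι → ℝ} {ε L : ℝ} {T : ℕ}

theorem lintegral_crossBound_le (A : QueryAlgorithm ι Ω) (ω : Ω)
    (hε : ∀ v w, v ≠ w → |K v w| ≤ ε) (hε0 : 0 < ε) (hL : 1 / 2 ≤ L)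
    (hcard : (Fintype.card ι : ℝ) ≤ Real.exp L) (hT : 0 < T) {k : ℕ} (hk : k ≤ T) :
    ∫⁻ a, ENNReal.ofReal (crossBound K (ε * √T) L (A.queried ω a k) a)
        ∂(Measure.pi fun _ => gaussianReal 0 1) ≤
      ENNReal.ofReal (132 * (ε ^ 2 * T * L ^ 2)) := by
  have hT' : (0 : ℝ) < T := Nat.cast_pos.2 hT
  have hb2 : (ε * √T) ^ 2 = ε ^ 2 * T := by rw [mul_pow, Real.sq_sqrt hT'.le]
  have hexp : ∀ s : ℝ, s ^ 2 = ((ε * √T)⁻¹) ^ 2 → ∀ v,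
      ∫⁻ a, ENNReal.ofReal (Real.exp (s * crossSum K (A.queried ω a k) a v))
        ∂(Measure.pi fun _ => gaussianReal 0 1) ≤ ENNReal.ofReal 2 := by
    intro s hs v
    refine (A.lintegral_exp_crossSum_le ω hε s v k).trans (ENNReal.ofReal_le_ofReal ?_)
    have h1 : (k : ℝ) * (s ^ 2 * ε ^ 2 / 2) ≤ 1 / 2 := by
      rw [hs, inv_pow, hb2]
      have : (k : ℝ) ≤ T := Nat.cast_le.2 hk
      have e : (k : ℝ) * ((ε ^ 2 * T)⁻¹ * ε ^ 2 / 2) = (k / T) / 2 := by field_simp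
      rw [e]
      have : (k : ℝ) / T ≤ 1 := (div_le_one hT').2 this
      linarith
    have h2 : Real.exp (1 / 2) ≤ 2 := by
      have h3 : Real.exp (1 / 2) ^ 2 = Real.exp 1 := by rw [← Real.exp_nat_mul]; norm_num
      nlinarith [Real.exp_one_lt_d9, Real.exp_pos (1 / 2)]
    exact (Real.exp_le_exp.2 h1).trans h2
  have hm : ∀ s v, Measurable fun a =>
      ENNReal.ofReal (Real.exp (s * crossSum K (A.queried ω a k) a v)) := fun s v =>
    A.measurable_queried ω k
      (F := fun S a => ENNReal.ofReal (Real.exp (s * crossSum K S a v))) fun S => by fun_prop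
  have hm2 : ∀ v, Measurable fun a =>
      ENNReal.ofReal (Real.exp ((ε * √T)⁻¹ * crossSum K (A.queried ω a k) a v)) +
        ENNReal.ofReal (Real.exp (-(ε * √T)⁻¹ * crossSum K (A.queried ω a k) a v)) := fun v =>
    (hm _ v).add (hm _ v)
  have hexpand : ∀ a, ENNReal.ofReal (crossBound K (ε * √T) L (A.queried ω a k) a) =
      ENNReal.ofReal (4 * (ε ^ 2 * T * L ^ 2)) + ENNReal.ofReal (8 * (ε ^ 2 * T) * Real.exp (-L)) *
        ∑ v, (ENNReal.ofReal (Real.exp ((ε * √T)⁻¹ * crossSum K (A.queried ω a k) a v)) +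
          ENNReal.ofReal (Real.exp (-(ε * √T)⁻¹ * crossSum K (A.queried ω a k) a v))) := by
    intro a
    simp only [← ENNReal.ofReal_add (Real.exp_pos _).le (Real.exp_pos _).le]
    rw [← ENNReal.ofReal_sum_of_nonneg fun v _ => by positivity,
      ← ENNReal.ofReal_mul (by positivity),
      ← ENNReal.ofReal_add (by positivity) (by positivity)]
    congr 1
    rw [crossBound, hb2]
    ring
  simp only [hexpand]
  rw [lintegral_add_left measurable_const, lintegral_const, measure_univ, mul_one,
    lintegral_const_mul' _ _ ENNReal.ofReal_ne_top,
    lintegral_finsetSum _ fun v _ => hm2 v]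
  have hsum : ∑ v, ∫⁻ a, (ENNReal.ofReal (Real.exp ((ε * √T)⁻¹ *
        crossSum K (A.queried ω a k) a v)) +
      ENNReal.ofReal (Real.exp (-(ε * √T)⁻¹ * crossSum K (A.queried ω a k) a v)))
        ∂(Measure.pi fun _ => gaussianReal 0 1) ≤ ENNReal.ofReal (4 * Real.exp L) := by
    calc _ ≤ ∑ v : ι, ENNReal.ofReal 4 := by
          refine Finset.sum_le_sum fun v _ => ?_
          rw [lintegral_add_left (hm _ v)]
          refine (add_le_add (hexp _ rfl v) (hexp _ (by ring) v)).trans ?_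
          rw [← ENNReal.ofReal_add (by norm_num) (by norm_num)]
          norm_num
      _ = ENNReal.ofReal (4 * Fintype.card ι) := by
          rw [Finset.sum_const, Finset.card_univ, nsmul_eq_mul, ← ENNReal.ofReal_natCast,
            ← ENNReal.ofReal_mul (by positivity), mul_comm]
      _ ≤ _ := ENNReal.ofReal_le_ofReal (by linarith)
  refine (add_le_add_right (mul_le_mul_right hsum _) _).trans ?_
  rw [← ENNReal.ofReal_mul (by positivity), ← ENNReal.ofReal_add (by positivity) (by positivity)]
  refine ENNReal.ofReal_le_ofReal ?_
  have he : Real.exp (-L) * Real.exp L = 1 := by rw [← Real.exp_add]; simp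
  have h4 : 8 * (ε ^ 2 * T) * Real.exp (-L) * (4 * Real.exp L) = 32 * (ε ^ 2 * T) := by
    linear_combination 32 * (ε ^ 2 * T) * he
  rw [h4]
  have h5 : 1 / 4 ≤ L ^ 2 := by nlinarith
  have h6 : 0 ≤ ε ^ 2 * T := by positivity
  nlinarith [mul_le_mul_of_nonneg_left h5 h6]

theorem lintegral_sq_crossForm_le (A : QueryAlgorithm ι Ω) (ω : Ω) (hK : ∀ v w, K v w = K w v)
    (hε : ∀ v w, v ≠ w → |K v w| ≤ ε) (hε0 : 0 < ε) (hL : 1 / 2 ≤ L)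
    (hcard : (Fintype.card ι : ℝ) ≤ Real.exp L) (hT : 0 < T) {k : ℕ} (hk : k ≤ T) :
    ∫⁻ a, ENNReal.ofReal (crossForm K (A.queried ω a k) a ^ 2)
        ∂(Measure.pi fun _ => gaussianReal 0 1) ≤
      ENNReal.ofReal (k * (132 * (ε ^ 2 * T * L ^ 2))) := by
  have hT' : (0 : ℝ) < T := Nat.cast_pos.2 hT
  induction k with
  | zero => simp [queried, history, crossForm]
  | succ k ih =>
    refine (A.lintegral_queried_succ_le ω (gaussianReal 0 1)
      (F := fun S a => ENNReal.ofReal (crossForm K S a ^ 2))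
      (G := fun S a => ENNReal.ofReal (crossForm K S a ^ 2) +
        ENNReal.ofReal (crossBound K (ε * √T) L S a))
      (fun S => by fun_prop) (fun S => by fun_prop) ?_ ?_ k).trans ?_
    · intro S a w hw
      simp only [crossForm_insert_update hK hw]
      rw [lintegral_sq_add_mul_gaussianReal, ENNReal.ofReal_add (sq_nonneg _) (sq_nonneg _)]
      gcongr
      exact sq_crossSum_le_crossBound (by positivity) (by linarith) S a w
    · intro S a
      exact le_self_add
    · have hm : Measurable fun a => ENNReal.ofReal (crossForm K (A.queried ω a k) a ^ 2) :=
        A.measurable_queried ω k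
          (F := fun S a => ENNReal.ofReal (crossForm K S a ^ 2)) fun S => by fun_prop
      rw [lintegral_add_left hm]
      refine (add_le_add (ih (by omega))
        (A.lintegral_crossBound_le ω hε hε0 hL hcard hT (by omega))).trans (le_of_eq ?_)
      rw [← ENNReal.ofReal_add (by positivity) (by positivity)]
      congr 1
      push_cast
      ring

/-- The expected error of the Gaussian comparison along the first `T` steps. -/
theorem lintegral_abs_crossForm_add_le (A : QueryAlgorithm ι Ω) (ω : Ω)
    (hK : ∀ v w, K v w = K w v) (hε : ∀ v w, v ≠ w → |K v w| ≤ ε) (hε0 : 0 < ε) (hL : 1 / 2 ≤ L)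
    (hcard : (Fintype.card ι : ℝ) ≤ Real.exp L) :
    ∫⁻ a, ENNReal.ofReal (|crossForm K (A.queried ω a T) a| +
        ∑ v ∈ A.queried ω a T, crossSum K (A.queried ω a T) a v ^ 2)
        ∂(Measure.pi fun _ => gaussianReal 0 1) ≤
      ENNReal.ofReal (67 * (T * ε * L) + 132 * (T * ε * L) ^ 2) := by
  rcases Nat.eq_zero_or_pos T with rfl | hT
  · simp [queried, history, crossForm]
  have hT' : (0 : ℝ) < T := Nat.cast_pos.2 hT
  set x := T * ε * L with hx
  have hx0 : 0 < x := by positivity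
  have hpt : ∀ a, ENNReal.ofReal (|crossForm K (A.queried ω a T) a| +
        ∑ v ∈ A.queried ω a T, crossSum K (A.queried ω a T) a v ^ 2) ≤
      ENNReal.ofReal (x / 2) +
        ENNReal.ofReal (1 / (2 * x)) * ENNReal.ofReal (crossForm K (A.queried ω a T) a ^ 2) +
        ENNReal.ofReal T * ENNReal.ofReal (crossBound K (ε * √T) L (A.queried ω a T) a) := by
    intro a
    set S := A.queried ω a T with hS
    rw [← ENNReal.ofReal_mul (by positivity), ← ENNReal.ofReal_mul (by positivity),
      ← ENNReal.ofReal_add (by positivity) (by positivity),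
      ← ENNReal.ofReal_add (by positivity)
        (mul_nonneg hT'.le (crossBound_nonneg S a))]
    refine ENNReal.ofReal_le_ofReal (add_le_add ?_ ?_)
    · have e : x / 2 + 1 / (2 * x) * crossForm K S a ^ 2 - |crossForm K S a| =
          (|crossForm K S a| - x) ^ 2 / (2 * x) := by
        field_simp
        rw [sub_sq, sq_abs]
        ring
      have : 0 ≤ (|crossForm K S a| - x) ^ 2 / (2 * x) := by positivity
      linarith
    · calc ∑ v ∈ S, crossSum K S a v ^ 2 ≤ ∑ v ∈ S, crossBound K (ε * √T) L S a :=
            Finset.sum_le_sum fun v _ =>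
              sq_crossSum_le_crossBound (by positivity) (by linarith) S a v
        _ = S.card * crossBound K (ε * √T) L S a := by rw [Finset.sum_const, nsmul_eq_mul]
        _ ≤ _ := mul_le_mul_of_nonneg_right (Nat.cast_le.2 (A.card_queried_le ω a T))
            (crossBound_nonneg S a)
  have hmF : Measurable fun a => ENNReal.ofReal (crossForm K (A.queried ω a T) a ^ 2) :=
    A.measurable_queried ω T
      (F := fun S a => ENNReal.ofReal (crossForm K S a ^ 2)) fun S => by fun_prop
  refine (lintegral_mono hpt).trans ?_
  rw [lintegral_add_left (by fun_prop), lintegral_add_left measurable_const, lintegral_const,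
    measure_univ, mul_one, lintegral_const_mul' _ _ ENNReal.ofReal_ne_top,
    lintegral_const_mul' _ _ ENNReal.ofReal_ne_top]
  refine (add_le_add (add_le_add_right (mul_le_mul_right
    (A.lintegral_sq_crossForm_le ω hK hε hε0 hL hcard hT le_rfl) _) _)
    (mul_le_mul_right (A.lintegral_crossBound_le ω hε hε0 hL hcard hT le_rfl) _)).trans ?_
  rw [← ENNReal.ofReal_mul (by positivity), ← ENNReal.ofReal_mul (by positivity),
      ← ENNReal.ofReal_add (by positivity) (by positivity),
      ← ENNReal.ofReal_add (by positivity) (by positivity)]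
  refine ENNReal.ofReal_le_ofReal ?_
  have e : T * (132 * (ε ^ 2 * T * L ^ 2)) = 132 * x ^ 2 := by rw [hx]; ring
  have e2 : 1 / (2 * x) * (132 * x ^ 2) = 66 * x := by field_simp; ring
  rw [e, e2]
  linarith

end QueryAlgorithm

/-- The error term of the Gaussian comparison on the coordinates in `S`. -/
noncomputable def crossError {ι : Type*} [DecidableEq ι] (K : ι → ι → ℝ) (S : Finset ι)
    (a : ι → ℝ) : ℝ :=
  |crossForm K S a| + ∑ v ∈ S, crossSum K S a v ^ 2

@[fun_prop]
theorem measurable_crossError {ι : Type*} [DecidableEq ι] {K : ι → ι → ℝ} (S : Finset ι) :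
    Measurable fun a => crossError K S a := by
  have h : Measurable fun a => |crossForm K S a| := (measurable_crossForm S).abs
  unfold crossError
  exact h.add (by fun_prop)

theorem crossSum_restrict {ι : Type*} [DecidableEq ι] (K : ι → ι → ℝ) (S : Finset ι) (a : ι → ℝ)
    (v : S) :
    crossSum (fun i j : S => K i j) Finset.univ (S.restrict a) v = crossSum K S a v := by
  rw [crossSum, crossSum, Finset.sum_erase_eq_sub (Finset.mem_univ v),
    Finset.sum_erase_eq_sub v.2]
  simp only [Finset.restrict]
  rw [Finset.sum_coe_sort S fun w => K v w * a w]

theorem crossError_restrict {ι : Type*} [DecidableEq ι] (K : ι → ι → ℝ) (S : Finset ι)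
    (a : ι → ℝ) :
    crossError (fun i j : S => K i j) Finset.univ (S.restrict a) = crossError K S a := by
  simp only [crossError, crossForm, crossSum_restrict]
  simp only [Finset.restrict]
  rw [Finset.sum_coe_sort S fun v => a v * crossSum K S a v,
    Finset.sum_coe_sort S fun v => crossSum K S a v ^ 2]

theorem measurable_inner_toLp {ι : Type*} {N : ℕ} (u : ι → EuclideanSpace ℝ (Fin N)) :
    Measurable fun (Ψ : Fin N → ℝ) (v : ι) => (inner ℝ (WithLp.toLp 2 Ψ) (u v) : ℝ) := by
  fun_prop

/-- Gaussian comparison for events that depend only on the coordinates in `S`. -/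
theorem pi_gaussianReal_le_map_inner_add_of_dependsOn {ι : Type*} [Fintype ι] [DecidableEq ι]
    {N : ℕ} (u : ι → EuclideanSpace ℝ (Fin N)) {ε : ℝ} (h1 : ∀ i, ‖u i‖ = 1)
    (hε : ∀ i j, i ≠ j → |inner ℝ (u i) (u j)| ≤ ε) (hε0 : 0 ≤ ε) {S : Finset ι}
    (hk : S.card * ε ≤ 1 / 2) {B : Set (ι → ℝ)} (hB : MeasurableSet B)
    (hdep : ∀ a b, (∀ v ∈ S, a v = b v) → a ∈ B → b ∈ B) :
    (Measure.pi fun _ : ι => gaussianReal 0 1) B ≤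
      ((Measure.pi fun _ : Fin N => gaussianReal 0 1).map
        (fun Ψ i => inner ℝ (WithLp.toLp 2 Ψ) (u i))) B +
      ∫⁻ a in B, ENNReal.ofReal (crossError (fun i j => inner ℝ (u i) (u j)) S a)
        ∂(Measure.pi fun _ : ι => gaussianReal 0 1) := by
  let ext : (S → ℝ) → ι → ℝ := fun c v => if h : v ∈ S then c ⟨v, h⟩ else 0
  have hext : Measurable ext := by
    refine measurable_pi_lambda _ fun v => ?_
    by_cases h : v ∈ S
    · simpa [ext, h] using measurable_pi_apply _
    · simp [ext, h]
  have hC : MeasurableSet (ext ⁻¹' B) := hext hB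
  have hBC : S.restrict ⁻¹' (ext ⁻¹' B) = B := by
    refine Set.ext fun a => ⟨fun h => hdep _ _ ?_ h, fun h => hdep _ _ ?_ h⟩ <;>
    · intro v hv
      simp [ext, hv]
  have hr : Measurable (S.restrict : (ι → ℝ) → S → ℝ) := by fun_prop
  have hpi : (Measure.pi fun _ : ι => gaussianReal 0 1).map S.restrict =
      Measure.pi fun _ : S => gaussianReal 0 1 := by
    rw [← Measure.infinitePi_eq_pi, Measure.infinitePi_map_restrict]
  have hproj : ((Measure.pi fun _ : Fin N => gaussianReal 0 1).map
        (fun Ψ i => inner ℝ (WithLp.toLp 2 Ψ) (u i))).map S.restrict =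
      (Measure.pi fun _ : Fin N => gaussianReal 0 1).map
        (fun Ψ (i : S) => inner ℝ (WithLp.toLp 2 Ψ) (u i)) := by
    rw [Measure.map_map hr (measurable_inner_toLp u)]
    rfl
  have h := pi_gaussianReal_le_map_inner_add (fun i : S => u i) (fun i => h1 i)
    (fun i j hij => hε i j fun h => hij (Subtype.ext h)) hε0 (by simpa using hk) hC
  have hint := setLIntegral_map (μ := Measure.pi fun _ : ι => gaussianReal 0 1) hC
    (f := fun c => ENNReal.ofReal
      (crossError (fun i j : S => inner ℝ (u i) (u j)) Finset.univ c)) (by fun_prop) hr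
  simp only [crossError_restrict (fun i j => inner ℝ (u i) (u j))] at hint
  rw [hBC, hpi] at hint
  rw [← hproj, Measure.map_apply hr hC, ← hpi, Measure.map_apply hr hC, hBC, hpi] at h
  rw [← hint]
  exact h

namespace QueryAlgorithm

section

variable {ι Ω : Type*} [MeasurableSpace ι] [MeasurableSpace Ω] [Fintype ι]

theorem output_eq_of_move_eq_inr (A : QueryAlgorithm ι Ω) {ω : Ω} {a : ι → ℝ} {T : ℕ} {b : Bool}
    (h : A.move ω (A.history ω a T) = Sum.inr b) : A.output ω a = b := by
  have hh : A.transcript ω a = A.history ω a T := by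
    rcases le_total T (Fintype.card ι) with hle | hle
    · obtain ⟨j, hj⟩ := Nat.exists_eq_add_of_le hle
      rw [transcript, hj, A.history_eq_of_move_eq_inr h]
    · obtain ⟨j, hj⟩ := Nat.exists_eq_add_of_le hle
      obtain ⟨b', hb'⟩ := A.exists_move_transcript_eq_inr ω a
      rw [hj]
      exact (A.history_eq_of_move_eq_inr hb' j).symm
  rw [output, hh, h]

theorem lt_card_and_lt_numQueries (A : QueryAlgorithm ι Ω) {ω : Ω} {a : ι → ℝ} {T : ℕ} {v : ι}
    (h : A.move ω (A.history ω a T) = Sum.inl v) :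
    T < Fintype.card ι ∧ T < A.numQueries ω a := by
  have hlen : (A.history ω a (T + 1)).length = T + 1 := by
    have := A.length_history ω a T (by simp [h])
    rw [history, h]
    simp [this]
  have hcard : T + 1 ≤ Fintype.card ι := by
    have := (A.nodup_history ω a (T + 1)).length_le_card
    simpa [hlen] using this
  refine ⟨hcard, ?_⟩
  have := A.length_history_mono ω a hcard
  simp only [hlen] at this
  exact this

variable [MeasurableSingletonClass ι]

theorem succ_mul_le_expectedQueries (A : QueryAlgorithm ι Ω) (P : Measure Ω)
    [IsProbabilityMeasure P] (μ : Measure (ι → ℝ)) [IsProbabilityMeasure μ] (T : ℕ) :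
    (T + 1) * (P.prod μ).real {p | ∃ v, A.move p.1 (A.history p.1 p.2 T) = Sum.inl v} ≤
      A.expectedQueries P μ := by
  have hm : Measurable fun p : Ω × (ι → ℝ) => (A.numQueries p.1 p.2 : ℝ) :=
    measurable_from_top.comp (A.measurable_length_history (Fintype.card ι))
  have hint : Integrable (fun p : Ω × (ι → ℝ) => (A.numQueries p.1 p.2 : ℝ)) (P.prod μ) := by
    refine Integrable.of_bound hm.aestronglyMeasurable (Fintype.card ι)
      (Filter.Eventually.of_forall fun p => ?_)
    simpa [numQueries, transcript] using A.length_history_le p.1 p.2 (Fintype.card ι)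
  have h := mul_meas_ge_le_integral_of_nonneg
    (Filter.Eventually.of_forall fun p => Nat.cast_nonneg _) hint (T + 1)
  refine le_trans (mul_le_mul_of_nonneg_left (measureReal_mono ?_) (by positivity)) h
  rintro p ⟨v, hv⟩
  have := (A.lt_card_and_lt_numQueries hv).2
  show (T : ℝ) + 1 ≤ (A.numQueries p.1 p.2 : ℝ)
  exact_mod_cast this

end

variable {ι Ω : Type*} [MeasurableSpace ι] [MeasurableSpace Ω] [Fintype ι] [DecidableEq ι]
  [MeasurableSingletonClass ι]

/-- Gaussian comparison for events that are decided by the first `T` steps. -/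
theorem pi_gaussianReal_le_map_inner_add_of_queried (A : QueryAlgorithm ι Ω) (ω : Ω) {N : ℕ}
    (u : ι → EuclideanSpace ℝ (Fin N)) {ε : ℝ} (h1 : ∀ i, ‖u i‖ = 1)
    (hε : ∀ i j, i ≠ j → |inner ℝ (u i) (u j)| ≤ ε) (hε0 : 0 ≤ ε) {T : ℕ}
    (hT : T * ε ≤ 1 / 2) {B : Set (ι → ℝ)} (hB : MeasurableSet B)
    (hdep : ∀ a b, (∀ v ∈ A.queried ω a T, a v = b v) → a ∈ B → b ∈ B) :
    (Measure.pi fun _ : ι => gaussianReal 0 1) B ≤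
      ((Measure.pi fun _ : Fin N => gaussianReal 0 1).map
        (fun Ψ i => inner ℝ (WithLp.toLp 2 Ψ) (u i))) B +
      ∫⁻ a, ENNReal.ofReal (crossError (fun i j => inner ℝ (u i) (u j)) (A.queried ω a T) a)
        ∂(Measure.pi fun _ : ι => gaussianReal 0 1) := by
  let BS : Finset ι → Set (ι → ℝ) := fun S => B ∩ {a | A.queried ω a T = S}
  have hq : ∀ S, MeasurableSet {a | A.queried ω a T = S} := fun S => by
    have hm : Measurable fun a => (if A.queried ω a T = S then 1 else 0 : ENNReal) :=
      A.measurable_queried ω T (F := fun R _ => (if R = S then 1 else 0 : ENNReal))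
        fun R => measurable_const
    convert hm (measurableSet_singleton 1) using 1
    ext a
    by_cases h : A.queried ω a T = S <;> simp [h]
  have hBS : ∀ S, MeasurableSet (BS S) := fun S => hB.inter (hq S)
  have hdisj : Pairwise (Function.onFun Disjoint BS) := fun S R hSR =>
    Set.disjoint_left.2 fun a h1 h2 => hSR (h1.2.symm.trans h2.2)
  have hU : ⋃ S, BS S = B := by
    ext a; simp [BS]
  have hmeas : ∀ μ : Measure (ι → ℝ), μ B = ∑ S, μ (BS S) := fun μ => by
    rw [← hU, measure_iUnion hdisj hBS, tsum_fintype]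
  have hpiece : ∀ S, (Measure.pi fun _ : ι => gaussianReal 0 1) (BS S) ≤
      ((Measure.pi fun _ : Fin N => gaussianReal 0 1).map
        (fun Ψ i => inner ℝ (WithLp.toLp 2 Ψ) (u i))) (BS S) +
      ∫⁻ a in BS S,
        ENNReal.ofReal (crossError (fun i j => inner ℝ (u i) (u j)) (A.queried ω a T) a)
        ∂(Measure.pi fun _ : ι => gaussianReal 0 1) := by
    intro S
    by_cases hS : S.card ≤ T
    · refine (pi_gaussianReal_le_map_inner_add_of_dependsOn u h1 hε hε0
        ((mul_le_mul_of_nonneg_right (Nat.cast_le.2 hS) hε0).trans hT) (hBS S) ?_).trans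
        (le_of_eq ?_)
      · rintro a b hab ⟨haB, haS⟩
        replace haS : A.queried ω a T = S := haS
        rw [← haS] at hab
        exact ⟨hdep a b hab haB, (A.queried_congr ω hab).trans haS⟩
      · congr 1
        refine setLIntegral_congr_fun (hBS S) fun a ha => ?_
        have : A.queried ω a T = S := ha.2
        simp only [this]
    · have : BS S = ∅ := Set.eq_empty_of_forall_notMem fun a ha =>
        hS ((show A.queried ω a T = S from ha.2) ▸ A.card_queried_le ω a T)
      simp [this]
  rw [hmeas, hmeas (Measure.map _ _)]
  refine (Finset.sum_le_sum fun S _ => hpiece S).trans ?_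
  rw [Finset.sum_add_distrib]
  gcongr
  rw [← tsum_fintype (L := SummationFilter.unconditional _), ← lintegral_iUnion hBS hdisj, hU]
  exact setLIntegral_le_lintegral _ _

theorem prod_le_prod_add (A : QueryAlgorithm ι Ω) (P : Measure Ω) [IsProbabilityMeasure P] {N : ℕ}
    (u : ι → EuclideanSpace ℝ (Fin N)) {ε L : ℝ} (h1 : ∀ i, ‖u i‖ = 1)
    (hε : ∀ i j, i ≠ j → |inner ℝ (u i) (u j)| ≤ ε) (hε0 : 0 < ε) (hL : 1 / 2 ≤ L)
    (hcard : (Fintype.card ι : ℝ) ≤ Real.exp L) {T : ℕ}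
    (hT : T * ε ≤ 1 / 2) {B : Set (Ω × (ι → ℝ))} (hB : MeasurableSet B)
    (hdep : ∀ ω a b, A.history ω a T = A.history ω b T → (ω, a) ∈ B → (ω, b) ∈ B) :
    (P.prod (Measure.pi fun _ : ι => gaussianReal 0 1)) B ≤
      (P.prod ((Measure.pi fun _ : Fin N => gaussianReal 0 1).map
        (fun Ψ i => inner ℝ (WithLp.toLp 2 Ψ) (u i)))) B +
      ENNReal.ofReal (67 * (T * ε * L) + 132 * (T * ε * L) ^ 2) := by
  have := Measure.isProbabilityMeasure_map (μ := Measure.pi fun _ : Fin N => gaussianReal 0 1)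
    (measurable_inner_toLp u).aemeasurable
  rw [Measure.prod_apply hB, Measure.prod_apply hB]
  set η := ENNReal.ofReal (67 * (T * ε * L) + 132 * (T * ε * L) ^ 2)
  have hη : η = ∫⁻ _, η ∂P := by simp
  rw [hη, ← lintegral_add_right _ measurable_const]
  refine lintegral_mono fun ω => ?_
  refine (A.pi_gaussianReal_le_map_inner_add_of_queried ω u h1 hε hε0.le hT
    (measurable_prodMk_left hB) fun a b hab ha => hdep ω a b ?_ ha).trans ?_
  · exact (A.history_congr_of_queried ω hab).symm
  · gcongr
    exact A.lintegral_abs_crossForm_add_le ω (fun v w => real_inner_comm _ _) hε hε0 hL hcard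

theorem abs_prod_real_sub_le (A : QueryAlgorithm ι Ω) (P : Measure Ω) [IsProbabilityMeasure P]
    {N : ℕ} (u : ι → EuclideanSpace ℝ (Fin N)) {ε L : ℝ} (h1 : ∀ i, ‖u i‖ = 1)
    (hε : ∀ i j, i ≠ j → |inner ℝ (u i) (u j)| ≤ ε) (hε0 : 0 < ε) (hL : 1 / 2 ≤ L)
    (hcard : (Fintype.card ι : ℝ) ≤ Real.exp L) {T : ℕ}
    (hT : T * ε ≤ 1 / 2) {B : Set (Ω × (ι → ℝ))} (hB : MeasurableSet B)
    (hdep : ∀ ω a b, A.history ω a T = A.history ω b T → (ω, a) ∈ B → (ω, b) ∈ B) :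
    |(P.prod (Measure.pi fun _ : ι => gaussianReal 0 1)).real B -
      (P.prod ((Measure.pi fun _ : Fin N => gaussianReal 0 1).map
        (fun Ψ i => inner ℝ (WithLp.toLp 2 Ψ) (u i)))).real B| ≤
      67 * (T * ε * L) + 132 * (T * ε * L) ^ 2 := by
  have := Measure.isProbabilityMeasure_map (μ := Measure.pi fun _ : Fin N => gaussianReal 0 1)
    (measurable_inner_toLp u).aemeasurable
  have hη : 0 ≤ 67 * (T * ε * L) + 132 * (T * ε * L) ^ 2 := by positivity
  have key : ∀ C : Set (Ω × (ι → ℝ)), MeasurableSet C →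
      (∀ ω a b, A.history ω a T = A.history ω b T → (ω, a) ∈ C → (ω, b) ∈ C) →
      (P.prod (Measure.pi fun _ : ι => gaussianReal 0 1)).real C ≤
      (P.prod ((Measure.pi fun _ : Fin N => gaussianReal 0 1).map
        (fun Ψ i => inner ℝ (WithLp.toLp 2 Ψ) (u i)))).real C +
        (67 * (T * ε * L) + 132 * (T * ε * L) ^ 2) := by
    intro C hC hCdep
    have h := A.prod_le_prod_add P u h1 hε hε0 hL hcard hT hC hCdep
    have h2 := ENNReal.toReal_mono (by finiteness) h
    rwa [ENNReal.toReal_add (by finiteness) (by finiteness), ENNReal.toReal_ofReal hη] at h2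
  have hl := key B hB hdep
  have hr := key Bᶜ hB.compl fun ω a b hab ha hb => ha (hdep ω b a hab.symm hb)
  rw [probReal_compl_eq_one_sub hB, probReal_compl_eq_one_sub hB] at hr
  rw [abs_le]
  constructor <;> linarith

end QueryAlgorithm

theorem isProbabilityMeasure_independentLaw {N : ℕ} (V : Finset (EuclideanSpace ℝ (Fin N))) :
    IsProbabilityMeasure (independentLaw V) := by
  unfold independentLaw
  infer_instance

theorem isProbabilityMeasure_projectedLaw {N : ℕ} (V : Finset (EuclideanSpace ℝ (Fin N))) :
    IsProbabilityMeasure (projectedLaw V) :=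
  Measure.isProbabilityMeasure_map
    (measurable_inner_toLp (Subtype.val : V → EuclideanSpace ℝ (Fin N))).aemeasurable

/-- An algorithm that distinguishes the two cases must, in either case, often make more than `T`
queries when `T` is small. -/
theorem DistinguishesWithBias.le_real_not_halted {N : ℕ} {V : Finset (EuclideanSpace ℝ (Fin N))}
    {Ω : Type*} [MeasurableSpace Ω] {A : QueryAlgorithm V Ω} {P : Measure Ω}
    [IsProbabilityMeasure P] {δ ε L : ℝ} (h : DistinguishesWithBias A P δ)
    (h1 : ∀ v ∈ V, ‖v‖ = 1) (hε : ∀ v ∈ V, ∀ w ∈ V, v ≠ w → |inner ℝ v w| ≤ ε) (hε0 : 0 < ε)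
    (hL : 1 / 2 ≤ L) (hcard : (V.card : ℝ) ≤ Real.exp L) {T : ℕ}
    (hT : T * ε * L ≤ min (1 / 4) (δ / 400)) :
    δ / 2 ≤ (P.prod (independentLaw V)).real
        {p | ∃ v, A.move p.1 (A.history p.1 p.2 T) = Sum.inl v} ∧
      δ / 2 ≤ (P.prod (projectedLaw V)).real
        {p | ∃ v, A.move p.1 (A.history p.1 p.2 T) = Sum.inl v} := by
  classical
  have hi := isProbabilityMeasure_independentLaw V
  have hp := isProbabilityMeasure_projectedLaw V
  set x := T * ε * L with hx
  have hx0 : 0 ≤ x := by positivity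
  have hx1 : x ≤ 1 / 4 := hT.trans (min_le_left _ _)
  have hx2 : x ≤ δ / 400 := hT.trans (min_le_right _ _)
  have hTε : T * ε ≤ 1 / 2 := by
    have : 0 ≤ T * ε := by positivity
    nlinarith
  have key : ∀ B : Set (Ω × (V → ℝ)), MeasurableSet B →
      (∀ ω a b, A.history ω a T = A.history ω b T → (ω, a) ∈ B → (ω, b) ∈ B) →
      |(P.prod (independentLaw V)).real B - (P.prod (projectedLaw V)).real B| ≤ δ / 4 := by
    intro B hB hdep
    refine (A.abs_prod_real_sub_le P (fun v : V => (v : EuclideanSpace ℝ (Fin N)))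
      (fun v => h1 v v.2) (fun v w hvw => hε v v.2 w w.2 fun h => hvw (Subtype.ext h)) hε0 hL
      (by simpa using hcard) hTε hB hdep).trans ?_
    rw [← hx]
    nlinarith
  set D : Set (Ω × (V → ℝ)) := {p | ∃ v, A.move p.1 (A.history p.1 p.2 T) = Sum.inl v} with hD
  set B : Set (Ω × (V → ℝ)) := {p | A.move p.1 (A.history p.1 p.2 T) = Sum.inr true} with hB
  set C : Set (Ω × (V → ℝ)) := {p | A.output p.1 p.2 = true} with hC
  have hBm : MeasurableSet B := A.measurable_move_history T (measurableSet_singleton (Sum.inr true))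
  have hDm : MeasurableSet D := by
    have : D = ⋃ v, {p | A.move p.1 (A.history p.1 p.2 T) = Sum.inl v} := by
      ext p; simp [hD]
    rw [this]
    exact MeasurableSet.iUnion fun v =>
      A.measurable_move_history T (measurableSet_singleton (Sum.inl v))
  have hBd := key B hBm fun ω a b hab ha => by
    simpa only [hB, Set.mem_ofPred_eq, hab] using ha
  have hDd := key D hDm fun ω a b hab ha => by
    simpa only [hD, Set.mem_ofPred_eq, hab] using ha
  have hBC : B ⊆ C := fun p hp => A.output_eq_of_move_eq_inr hp
  have hCBD : C ⊆ B ∪ D := by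
    intro p hp
    cases hm : A.move p.1 (A.history p.1 p.2 T) with
    | inl v => exact Or.inr ⟨v, hm⟩
    | inr b =>
      have : b = true := (A.output_eq_of_move_eq_inr hm).symm.trans hp
      exact Or.inl (show A.move p.1 (A.history p.1 p.2 T) = Sum.inr true by rw [hm, this])
  have lower : ∀ μ : Measure (V → ℝ), IsProbabilityMeasure μ →
      (P.prod μ).real B ≤ A.acceptProb P μ := fun μ _ => measureReal_mono hBC
  have upper : ∀ μ : Measure (V → ℝ), IsProbabilityMeasure μ →
      A.acceptProb P μ ≤ (P.prod μ).real B + (P.prod μ).real D := fun μ _ =>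
    (measureReal_mono hCBD).trans (measureReal_union_le _ _)
  have l1 := lower _ hi
  have l2 := lower _ hp
  have u1 := upper _ hi
  have u2 := upper _ hp
  rw [abs_le] at hBd hDd
  rw [DistinguishesWithBias, le_abs] at h
  rcases h with h | h <;> constructor <;> linarith [hBd.1, hBd.2, hDd.1, hDd.2]

theorem mainTheorem3 (δ : ℝ) (hδ : 0 < δ) :
    ∃ c : ℝ, 0 < c ∧
      ∀ (N M : ℕ) (ε : ℝ) (V : Finset (EuclideanSpace ℝ (Fin N))),
        0 < ε → ε ≤ 1 → V.card ≤ M →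
        (∀ v ∈ V, ‖v‖ = 1) →
        (∀ v ∈ V, ∀ w ∈ V, v ≠ w → |inner ℝ v w| ≤ ε) →
        ∀ (Ω : Type*) [MeasurableSpace Ω] (P : Measure Ω) [IsProbabilityMeasure P]
          (A : QueryAlgorithm V Ω),
          DistinguishesWithBias A P δ →
            c * ((1 / ε) / Real.log (M / ε)) ≤ A.expectedQueries P (independentLaw V) ∧
            c * ((1 / ε) / Real.log (M / ε)) ≤ A.expectedQueries P (projectedLaw V) := by
  classical
  set c := min (1 / 4) (δ / 400) with hc
  have hc0 : 0 < c := by positivity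
  refine ⟨c * (δ / 2), by positivity, ?_⟩
  intro N M ε V hε0 hε1 hVM h1 hε Ω _ P _ A h
  have hi := isProbabilityMeasure_independentLaw V
  have hp := isProbabilityMeasure_projectedLaw V
  rcases Nat.lt_or_ge 1 V.card with hV | hV
  · have hM : (2 : ℝ) ≤ M := by exact_mod_cast hV.trans_le hVM
    have hMε : (M : ℝ) ≤ M / ε := le_div_self (by positivity) hε0 hε1
    set L := Real.log (M / ε) with hLdef
    have hL : 1 / 2 ≤ L := by
      have h2 : Real.log 2 ≤ L := Real.log_le_log (by norm_num) (hM.trans hMε)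
      linarith [Real.log_two_gt_d9]
    have hcard : (V.card : ℝ) ≤ Real.exp L := by
      rw [hLdef, Real.exp_log (by positivity)]
      exact (Nat.cast_le.2 hVM).trans hMε
    have hεL : 0 < ε * L := by positivity
    set T := ⌊c / (ε * L)⌋₊ with hTdef
    have hT : T * ε * L ≤ c := by
      rw [mul_assoc, ← le_div_iff₀ hεL]
      exact Nat.floor_le (by positivity)
    have hT1 : c / (ε * L) ≤ T + 1 := (Nat.lt_floor_add_one _).le
    obtain ⟨hD1, hD2⟩ := h.le_real_not_halted h1 hε hε0 hL hcard hT
    have e : c * (δ / 2) * (1 / ε / L) = c / (ε * L) * (δ / 2) := by field_simp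
    rw [e]
    constructor
    · exact (mul_le_mul hT1 hD1 (by positivity) (by positivity)).trans
        (A.succ_mul_le_expectedQueries P _ T)
    · exact (mul_le_mul hT1 hD2 (by positivity) (by positivity)).trans
        (A.succ_mul_le_expectedQueries P _ T)
  · exfalso
    have hε' : ∀ v ∈ V, ∀ w ∈ V, v ≠ w → |(inner ℝ v w : ℝ)| ≤ c := fun v hv w hw hvw =>
      absurd (Finset.card_le_one.1 hV v hv w hw) hvw
    have hcard : (V.card : ℝ) ≤ Real.exp (1 / 2) :=
      (by exact_mod_cast hV : (V.card : ℝ) ≤ 1).trans (Real.one_le_exp (by norm_num))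
    have hD := (h.le_real_not_halted (T := 1) h1 hε' hc0 le_rfl hcard
      (by rw [← hc]; push_cast; linarith)).1
    rcases Set.eq_empty_or_nonempty
      {p : Ω × (V → ℝ) | ∃ v, A.move p.1 (A.history p.1 p.2 1) = Sum.inl v} with hE | ⟨p, v, hv⟩
    · rw [hE, measureReal_empty] at hD
      linarith
    · have := (A.lt_card_and_lt_numQueries hv).1
      rw [Fintype.card_coe] at this
      omega
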